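/- Let $T=\mathbb C/\Lambda$ be a complex elliptic curve and let $f:T\to\mathbb P^1$ be a morphism (holomorphic map) of degree $3$ with triple ramification at $3$ points. Let $M=\operatorname{br}(f)\subset\mathbb P^1$ be its branch locus and let $m\ge 1$ be an integer. Consider all sets of the form $f'(T'[3m])\setminus M$, where $T'$ is a complex elliptic curve, $f':T'\to\mathbb P^1$ is a morphism of degree $3$ with triple ramification at $3$ points and with $\operatorname{br}(f')=M$, and $T'[3m]$ is the set of $3m$-torsion points of $T'$ for the group law whose zero is some ramification point of $f'$. Then all these sets are equal to one and the same set, denoted $\mathbb P^1_M[3m]$ and called the set of equianharmonic $3m$-torsion parameters relative to $M$. It has exactly $3m^2-1$ elements. Moreover, the set $f^{-1}(M\cup\mathbb P^1_M[3m])$ is a translate of the subgroup of $3m$-torsion points of $T$. -/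

import Mathlib

open scoped LinearAlgebra.Projectivization Topology

namespace TripleCover

noncomputable section

/-- The complex projective line `P¹`. -/
abbrev P1 : Type := ℙ ℂ (Fin 2 → ℂ)

/-- The standard local coordinate of `P¹` centred at `y`. In the affine coordinate `u = x₀ / x₁` it
is `x ↦ u x - u y` if `y ≠ [1 : 0]`, and `x ↦ 1 / u x` if `y = [1 : 0]`. -/
def localCoord (y x : P1) : ℂ :=
  if y.rep 1 = 0 then x.rep 1 / x.rep 0 else x.rep 0 / x.rep 1 - y.rep 0 / y.rep 1

/-- A map from the complex torus `ℂ / Λ` to `P¹` is a morphism if it is holomorphic: around every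
point it is given by homogeneous coordinates that are holomorphic and have no common zero. -/
def IsMorphism {Λ : Submodule ℤ ℂ} (f : ℂ ⧸ Λ → P1) : Prop :=
  ∀ p : ℂ ⧸ Λ, ∃ g : ℂ → Fin 2 → ℂ, AnalyticAt ℂ g 0 ∧
    ∀ᶠ w in 𝓝 (0 : ℂ), ∃ h : g w ≠ 0,
      f (p + Submodule.Quotient.mk w) = Projectivization.mk ℂ (g w) h

/-- The ramification index (multiplicity) of `f` at `p`: the order of vanishing at `p` of `f`, read
in the local coordinate of `P¹` centred at `f p` and the local coordinate of `ℂ / Λ` at `p`. -/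
def ramificationIndex {Λ : Submodule ℤ ℂ} (f : ℂ ⧸ Λ → P1) (p : ℂ ⧸ Λ) : ℕ∞ :=
  analyticOrderAt (fun w : ℂ => localCoord (f p) (f (p + Submodule.Quotient.mk w))) 0

/-- `f` has degree `d`: every fibre is finite and consists of `d` points, counted with
multiplicity. -/
def HasDegree {Λ : Submodule ℤ ℂ} (f : ℂ ⧸ Λ → P1) (d : ℕ) : Prop :=
  ∀ y : P1, (f ⁻¹' {y}).Finite ∧ ∑ᶠ p ∈ f ⁻¹' {y}, ramificationIndex f p = d

/-- The branch locus of `f`: the set of images of the ramification points. -/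
def branchLocus {Λ : Submodule ℤ ℂ} (f : ℂ ⧸ Λ → P1) : Set P1 :=
  f '' {p | 1 < ramificationIndex f p}

/-- `f` is a morphism of degree 3 with triple ramification at 3 points. -/
structure IsTripleCover {Λ : Submodule ℤ ℂ} (f : ℂ ⧸ Λ → P1) : Prop where
  isMorphism : IsMorphism f
  hasDegree : HasDegree f 3
  triple : ∃ a b c : ℂ ⧸ Λ, a ≠ b ∧ a ≠ c ∧ b ≠ c ∧
    ramificationIndex f a = 3 ∧ ramificationIndex f b = 3 ∧ ramificationIndex f c = 3

/-- The `n`-torsion points of `ℂ / Λ` for the group law whose zero is the point `o`, namely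
`(p, q) ↦ p + q - o`. -/
def torsionWithZero {Λ : Submodule ℤ ℂ} (o : ℂ ⧸ Λ) (n : ℕ) : Set (ℂ ⧸ Λ) :=
  {p | n • (p - o) = 0}

/-- `S = f (T[n]) \ M`, where `T = ℂ / Λ` is an elliptic curve, `f : T → P¹` is a morphism of degree
3 with triple ramification at 3 points and branch locus `M`, and the zero `o` of the group law on
`T` is a ramification point of `f`. -/
def IsTorsionImage (M : Set P1) (n : ℕ) (S : Set P1) : Prop :=
  ∃ (Λ : Submodule ℤ ℂ) (_ : DiscreteTopology Λ) (_ : IsZLattice ℝ Λ) (f : ℂ ⧸ Λ → P1)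
    (o : ℂ ⧸ Λ), IsTripleCover f ∧ branchLocus f = M ∧ 1 < ramificationIndex f o ∧
      S = (f '' torsionWithZero o n) \ M

/-- The set `P¹_M[n]` of equianharmonic `n`-torsion parameters relative to the marking `M` of `P¹`:
the points of the sets `f (T[n]) \ M`, for all choices of `T`, `f` and the zero of `T`. -/
def equianharmonicParameters (M : Set P1) (n : ℕ) : Set P1 :=
  ⋃₀ {S | IsTorsionImage M n S}

end

end TripleCover

namespace TripleCover

open Filter

/-! On the line there is a cubic differential with a double pole at each of the three branch points;
in an affine coordinate with one of them at infinity it is `dx ^ 3 / (x ^ 2 * (x - b) ^ 2)`. Where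
`x = w ^ 3` the zero of order six of `dx ^ 3` cancels the pole, so the pullback under a triple cover
is `h dw ^ 3` with `h` holomorphic, doubly periodic and nonzero at the triple points. By Liouville
`h` is a nonzero constant (`IsTripleOver.exists_const`).

Hence there is no further ramification, and around a triple point the affine coordinate of the cover
solves `u' ^ 3 = K * P u`, where `P` depends only on the branch points. A solution with a triple
zero is unique up to scaling the variable, by a factor free up to cube roots of unity
(`exists_eventually_eq_comp_mul`). So covers with the same branch locus differ by a similarity of
the universal covers (`IsTripleCover.exists_similarity`), which carries lattice into lattice and
torsion to torsion; by symmetry the images of the torsion agree.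

Comparing a cover with itself shows invariance under rotation by a third of a turn about a
ramification point. Ramification points are fixed by this rotation, so they differ by `3`-torsion
and the choice of zero does not affect `3m`-torsion. The other fibres are free orbits of the
rotation, so the torsion set is a union of fibres. Removing the three ramification points leaves
`9m² - 3` points in fibres of size three. -/

/-! ### Rigidity of `u' ^ 3 = K * P u` at a triple zero -/

/-- An analytic function with a zero of order three is the cube of a local coordinate. -/
lemma exists_eventually_eq_cube {u : ℂ → ℂ} (hu : AnalyticAt ℂ u 0)
    (h3 : analyticOrderAt u 0 = 3) :
    ∃ U : ℂ → ℂ, AnalyticAt ℂ U 0 ∧ U 0 = 0 ∧ deriv U 0 ≠ 0 ∧ ∀ᶠ z in 𝓝 0, u z = U z ^ 3 := by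
  obtain ⟨e, he, he0, hue⟩ := (hu.analyticOrderAt_eq_natCast (n := 3)).1 h3
  obtain ⟨c, hc⟩ := IsAlgClosed.exists_pow_nat_eq (e 0) (n := 3) (by norm_num)
  have hc0 : c ≠ 0 := by
    rintro rfl
    exact he0 (by rw [← hc]; simp)
  -- An analytic cube root of the unit `e`: the quotient `e z / e 0` is near `1`, where the
  -- principal logarithm is analytic.
  have hr : AnalyticAt ℂ (fun z => c * Complex.exp (Complex.log (e z / e 0) / 3)) 0 := by
    have : AnalyticAt ℂ (fun z => Complex.log (e z / e 0)) 0 :=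
      (he.div analyticAt_const he0).clog (by simp [he0])
    fun_prop
  refine ⟨fun z => z * (c * Complex.exp (Complex.log (e z / e 0) / 3)),
    analyticAt_id.mul hr, by simp, ?_, ?_⟩
  · have := ((hasDerivAt_id (0 : ℂ)).mul hr.differentiableAt.hasDerivAt).deriv
    simp only [Pi.mul_def, id] at this
    rw [this]
    simp [hc0, he0]
  · filter_upwards [hue, he.continuousAt.eventually_ne he0] with z hz hez
    rw [hz, mul_pow, mul_pow, hc, ← Complex.exp_nat_mul]
    have : ((3 : ℕ) : ℂ) * (Complex.log (e z / e 0) / 3) = Complex.log (e z / e 0) := by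
      push_cast; ring
    rw [this, Complex.exp_log (div_ne_zero hez he0)]
    simp only [sub_zero, smul_eq_mul]
    field_simp

/-- An analytic function fixing `0` the cube of whose derivative is constant is linear. -/
lemma eventually_eq_mul_of_deriv_cube {k : ℂ → ℂ} (hk : AnalyticAt ℂ k 0) (hk0 : k 0 = 0)
    {c : ℂ} (hc : c ≠ 0) (h : ∀ᶠ z in 𝓝[≠] 0, deriv k z ^ 3 = c) :
    ∀ᶠ z in 𝓝 0, k z = deriv k 0 * z := by
  have hd : AnalyticAt ℂ (deriv k) 0 := hk.deriv
  have h' : ∀ᶠ z in 𝓝 0, deriv k z ^ 3 - c = 0 := by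
    refine ((hd.pow 3).sub analyticAt_const).frequently_zero_iff_eventually_zero.1 ?_
    exact (h.mono fun z hz => by simp [hz]).frequently
  have h0 : deriv k 0 ^ 3 = c := sub_eq_zero.1 h'.self_of_nhds
  have hκ : deriv k 0 ≠ 0 := by
    intro h
    rw [h] at h0
    exact hc (by rw [← h0]; simp)
  -- The cofactor of `deriv k z - deriv k 0` in the difference of cubes. It is nonzero near `0`,
  -- which forces `deriv k` to be constant there.
  have hq : ∀ᶠ z in 𝓝 0, deriv k z ^ 2 + deriv k z * deriv k 0 + deriv k 0 ^ 2 ≠ 0 := by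
    have : ContinuousAt (fun z => deriv k z ^ 2 + deriv k z * deriv k 0 + deriv k 0 ^ 2) 0 := by
      have := hd.continuousAt
      fun_prop
    refine this.eventually_ne ?_
    have : deriv k 0 ^ 2 + deriv k 0 * deriv k 0 + deriv k 0 ^ 2 = 3 * deriv k 0 ^ 2 := by ring
    rw [this]
    exact mul_ne_zero (by norm_num) (pow_ne_zero 2 hκ)
  have hconst : ∀ᶠ z in 𝓝 0, deriv (fun w => k w - deriv k 0 * w) z = 0 := by
    filter_upwards [h', hq, hk.eventually_analyticAt] with z h1 h2 h3
    have h4 : deriv (fun w => k w - deriv k 0 * w) z = deriv k z - deriv k 0 := by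
      simpa [Pi.sub_def] using (h3.differentiableAt.hasDerivAt.sub
        ((hasDerivAt_id z).const_mul (deriv k 0))).deriv
    rw [h4]
    refine (mul_eq_zero.1 ?_).resolve_right h2
    rw [← h0] at h1
    linear_combination h1
  have hA : AnalyticAt ℂ (fun w => k w - deriv k 0 * w) 0 := by fun_prop
  have := hA.analyticOrderAt_deriv_add_one
  rw [analyticOrderAt_eq_top.2 hconst, top_add] at this
  filter_upwards [analyticOrderAt_eq_top.1 this.symm] with z hz
  simp only [hk0, mul_zero, sub_zero] at hz
  exact sub_eq_zero.1 hz

/-- Two solutions with a triple zero of the equations `u' ^ 3 = K * P u` and `v' ^ 3 = K' * P v`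
agree up to scaling the variable, and the scaling factor is arbitrary up to a cube root of
unity. -/
lemma exists_eventually_eq_comp_mul {u v P : ℂ → ℂ} {K K' : ℂ}
    (hu : AnalyticAt ℂ u 0) (hv : AnalyticAt ℂ v 0) (hu3 : analyticOrderAt u 0 = 3)
    (hv3 : analyticOrderAt v 0 = 3) (hK : K ≠ 0) (hK' : K' ≠ 0)
    (hP : ∀ᶠ x in 𝓝[≠] 0, P x ≠ 0)
    (hdu : ∀ᶠ z in 𝓝 0, deriv u z ^ 3 = K * P (u z))
    (hdv : ∀ᶠ z in 𝓝 0, deriv v z ^ 3 = K' * P (v z)) :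
    ∃ κ : ℂ, κ ≠ 0 ∧ ∀ ζ : ℂ, ζ ^ 3 = 1 → ∀ᶠ z in 𝓝 0, u z = v (ζ * κ * z) := by
  obtain ⟨U, hU, hU0, hU', hUu⟩ := exists_eventually_eq_cube hu hu3
  obtain ⟨V, hV, hV0, hV', hVv⟩ := exists_eventually_eq_cube hv hv3
  refine ⟨deriv U 0 / deriv V 0, div_ne_zero hU' hV', fun ζ hζ => ?_⟩
  set R := hV.hasStrictDerivAt.localInverse V (deriv V 0) 0 hV' with hR
  have hRa : AnalyticAt ℂ R 0 := by
    have := hV.analyticAt_localInverse hV'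
    rwa [hV0] at this
  have hR0 : R 0 = 0 := by
    have := (hV.hasStrictDerivAt.eventually_left_inverse hV').self_of_nhds
    rwa [hV0] at this
  have hVR : ∀ᶠ x in 𝓝 0, V (R x) = x := by
    have := hV.hasStrictDerivAt.eventually_right_inverse hV'
    rwa [hV0] at this
  have hζU : AnalyticAt ℂ (fun z => ζ * U z) 0 := analyticAt_const.mul hU
  -- `k` is `V⁻¹ ∘ (ζ U)`, so that `v ∘ k = (ζ U) ^ 3 = u`. It remains to see that `k` is linear.
  set k : ℂ → ℂ := fun z => R (ζ * U z) with hk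
  have hka : AnalyticAt ℂ k 0 := AnalyticAt.fun_comp (by simpa [hU0] using hRa) hζU
  have hk0 : k 0 = 0 := by simp [hk, hU0, hR0]
  have hkt : Tendsto k (𝓝 0) (𝓝 0) := by
    have := hka.continuousAt.tendsto
    rwa [hk0] at this
  have hVk : ∀ᶠ z in 𝓝 0, V (k z) = ζ * U z := by
    have : Tendsto (fun z => ζ * U z) (𝓝 0) (𝓝 0) := by
      have := hζU.continuousAt.tendsto
      rwa [hU0, mul_zero] at this
    exact this.eventually hVR
  have hvk : ∀ᶠ z in 𝓝 0, v (k z) = u z := by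
    filter_upwards [hVk, hUu, hkt.eventually hVv] with z h1 h2 h3
    rw [h3, h1, h2, mul_pow, hζ, one_mul]
  have hdk : deriv V 0 * deriv k 0 = ζ * deriv U 0 := by
    have h1 : HasDerivAt (fun z => V (k z)) (deriv V 0 * deriv k 0) 0 := by
      have hVd : HasDerivAt V (deriv V 0) (k 0) := by
        rw [hk0]
        exact hV.differentiableAt.hasDerivAt
      exact hVd.comp 0 hka.differentiableAt.hasDerivAt
    have h2 : HasDerivAt (fun z => ζ * U z) (ζ * deriv U 0) 0 :=
      hU.differentiableAt.hasDerivAt.const_mul ζ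
    exact h1.unique (h2.congr_of_eventuallyEq hVk)
  have hut : Tendsto u (𝓝[≠] 0) (𝓝[≠] 0) := by
    refine tendsto_nhdsWithin_iff.2 ⟨?_, ?_⟩
    · have h0 : u 0 = 0 := by
        have := hUu.self_of_nhds
        simpa [hU0] using this
      have := hu.continuousAt.tendsto
      rw [h0] at this
      exact this.mono_left nhdsWithin_le_nhds
    · filter_upwards [nhdsWithin_le_nhds hUu,
        hU.differentiableAt.hasDerivAt.eventually_ne hU' (c := 0)] with z h1 h2
      rw [Set.mem_compl_singleton_iff, h1]
      exact pow_ne_zero 3 h2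
  have hcube : ∀ᶠ z in 𝓝[≠] 0, deriv k z ^ 3 = K / K' := by
    filter_upwards [hut.eventually hP, nhdsWithin_le_nhds hvk.eventually_nhds,
      nhdsWithin_le_nhds (hkt.eventually hdv), nhdsWithin_le_nhds hdu,
      nhdsWithin_le_nhds hka.eventually_analyticAt,
      nhdsWithin_le_nhds (hkt.eventually hv.eventually_analyticAt)] with z h1 h2 h3 h4 h5 h6
    have h7 : deriv u z = deriv v (k z) * deriv k z := by
      rw [← Filter.EventuallyEq.deriv_eq h2]
      exact (h6.differentiableAt.hasDerivAt.comp z h5.differentiableAt.hasDerivAt).deriv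
    rw [h7, mul_pow, h3, h2.self_of_nhds] at h4
    rw [eq_div_iff hK']
    refine mul_right_cancel₀ h1 ?_
    linear_combination h4
  filter_upwards [eventually_eq_mul_of_deriv_cube hka hk0 (div_ne_zero hK hK') hcube, hvk]
    with z h1 h2
  rw [← h2, h1]
  congr 2
  field_simp
  linear_combination hdk

/-! ### Homogeneous coordinates and orders of vanishing -/

/-- The determinant of two vectors of `ℂ²`. -/
def wedge (x y : Fin 2 → ℂ) : ℂ := x 0 * y 1 - x 1 * y 0

lemma wedge_smul_left (a : ℂ) (x y : Fin 2 → ℂ) : wedge (a • x) y = a * wedge x y := by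
  simp only [wedge, Pi.smul_apply, smul_eq_mul]; ring

lemma wedge_smul_right (a : ℂ) (x y : Fin 2 → ℂ) : wedge x (a • y) = a * wedge x y := by
  simp only [wedge, Pi.smul_apply, smul_eq_mul]; ring

lemma wedge_self (x : Fin 2 → ℂ) : wedge x x = 0 := by
  simp only [wedge]; ring

lemma exists_smul_of_wedge_eq_zero {x y : Fin 2 → ℂ} (hx : x ≠ 0) (h : wedge x y = 0) :
    ∃ a : ℂ, y = a • x := by
  simp only [wedge] at h
  by_cases h0 : x 0 = 0
  · have h1 : x 1 ≠ 0 := fun h1 => hx (by ext i; fin_cases i <;> simp [h0, h1])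
    refine ⟨y 1 / x 1, ?_⟩
    ext i
    fin_cases i
    · simp only [Fin.zero_eta, Pi.smul_apply, smul_eq_mul]
      rw [h0] at h ⊢
      simpa [h1] using h
    · simp [h1]
  · refine ⟨y 0 / x 0, ?_⟩
    ext i
    fin_cases i
    · simp [h0]
    · simp only [Fin.mk_one, Pi.smul_apply, smul_eq_mul]
      field_simp
      linear_combination h

lemma mk_eq_mk_iff_wedge {x y : Fin 2 → ℂ} (hx : x ≠ 0) (hy : y ≠ 0) :
    Projectivization.mk ℂ x hx = Projectivization.mk ℂ y hy ↔ wedge x y = 0 := by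
  rw [eq_comm, Projectivization.mk_eq_mk_iff']
  constructor
  · rintro ⟨a, rfl⟩
    rw [wedge_smul_right, wedge_self, mul_zero]
  · intro h
    obtain ⟨a, ha⟩ := exists_smul_of_wedge_eq_zero hx h
    exact ⟨a, ha.symm⟩

lemma eq_mk_iff_wedge {y : P1} {x : Fin 2 → ℂ} (hx : x ≠ 0) :
    y = Projectivization.mk ℂ x hx ↔ wedge y.rep x = 0 := by
  rw [← mk_eq_mk_iff_wedge y.rep_nonzero hx, Projectivization.mk_rep]

lemma eq_iff_wedge {y y' : P1} : y = y' ↔ wedge y.rep y'.rep = 0 := by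
  rw [← eq_mk_iff_wedge y'.rep_nonzero, Projectivization.mk_rep]

/-- `g` is a vector of holomorphic homogeneous coordinates of `F` around `z`. -/
def IsLiftAt (F : ℂ → P1) (g : ℂ → Fin 2 → ℂ) (z : ℂ) : Prop :=
  AnalyticAt ℂ g z ∧ ∀ᶠ w in 𝓝 z, ∃ h : g w ≠ 0, F w = Projectivization.mk ℂ (g w) h

section Lift

variable {F : ℂ → P1} {g g₁ g₂ : ℂ → Fin 2 → ℂ} {z : ℂ}

lemma IsLiftAt.ne_zero (hg : IsLiftAt F g z) : g z ≠ 0 := hg.2.self_of_nhds.1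

lemma IsLiftAt.eventually_isLiftAt (hg : IsLiftAt F g z) : ∀ᶠ w in 𝓝 z, IsLiftAt F g w := by
  filter_upwards [hg.1.eventually_analyticAt, hg.2.eventually_nhds] with w h1 h2
  exact ⟨h1, h2⟩

lemma IsLiftAt.apply_eq_iff (hg : IsLiftAt F g z) (y : P1) :
    F z = y ↔ wedge y.rep (g z) = 0 := by
  obtain ⟨h, hF⟩ := hg.2.self_of_nhds
  rw [hF, eq_comm, eq_mk_iff_wedge]

lemma IsLiftAt.comp (hg : IsLiftAt F g z) {φ : ℂ → ℂ} {x : ℂ} (hφ : AnalyticAt ℂ φ x)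
    (hx : φ x = z) : IsLiftAt (F ∘ φ) (g ∘ φ) x := by
  subst hx
  exact ⟨hg.1.comp hφ, hφ.continuousAt.tendsto.eventually hg.2⟩

lemma analyticAt_wedge {a b : ℂ → Fin 2 → ℂ} (ha : AnalyticAt ℂ a z) (hb : AnalyticAt ℂ b z) :
    AnalyticAt ℂ (fun w => wedge (a w) (b w)) z := by
  have ha' := analyticAt_pi_iff.1 ha
  have hb' := analyticAt_pi_iff.1 hb
  exact ((ha' 0).mul (hb' 1)).sub ((ha' 1).mul (hb' 0))

lemma hasDerivAt_wedge (v : Fin 2 → ℂ) (hg : AnalyticAt ℂ g z) :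
    HasDerivAt (fun w => wedge v (g w)) (wedge v (deriv g z)) z := by
  have h := hasDerivAt_pi.1 hg.differentiableAt.hasDerivAt
  exact ((h 1).const_mul (v 0)).sub ((h 0).const_mul (v 1))

/-- Two vectors of homogeneous coordinates of the same map differ by a unit. -/
lemma IsLiftAt.exists_smul (h₁ : IsLiftAt F g₁ z) (h₂ : IsLiftAt F g₂ z) :
    ∃ c : ℂ → ℂ, AnalyticAt ℂ c z ∧ c z ≠ 0 ∧ ∀ᶠ w in 𝓝 z, g₂ w = c w • g₁ w := by
  have hw : ∀ᶠ w in 𝓝 z, wedge (g₁ w) (g₂ w) = 0 := by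
    filter_upwards [h₁.2, h₂.2] with w ⟨a, ha⟩ ⟨b, hb⟩
    rw [← mk_eq_mk_iff_wedge a b, ← ha, hb]
  have hi : ∃ i, g₁ z i ≠ 0 := by
    by_contra! h
    exact h₁.ne_zero (funext h)
  obtain ⟨i, hi⟩ := hi
  have ha₁ := analyticAt_pi_iff.1 h₁.1 i
  have ha₂ := analyticAt_pi_iff.1 h₂.1 i
  have key : ∀ᶠ w in 𝓝 z, g₂ w = (g₂ w i / g₁ w i) • g₁ w := by
    filter_upwards [hw, ha₁.continuousAt.eventually_ne hi, h₁.eventually_isLiftAt] with w h h' h''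
    obtain ⟨a, ha⟩ := exists_smul_of_wedge_eq_zero h''.ne_zero h
    rw [ha]
    simp [h']
  refine ⟨fun w => g₂ w i / g₁ w i, ha₂.div ha₁ hi, fun h => ?_, key⟩
  have := key.self_of_nhds
  rw [show g₂ z i / g₁ z i = 0 from h, zero_smul] at this
  exact h₂.ne_zero this

lemma localCoord_mk (y : P1) {x : Fin 2 → ℂ} (hx : x ≠ 0) :
    localCoord y (Projectivization.mk ℂ x hx) =
      if y.rep 1 = 0 then x 1 / x 0 else x 0 / x 1 - y.rep 0 / y.rep 1 := by
  obtain ⟨a, ha⟩ := Projectivization.exists_smul_eq_mk_rep ℂ x hx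
  have ha0 : (a : ℂ) ≠ 0 := a.ne_zero
  have h : ∀ i, (Projectivization.mk ℂ x hx).rep i = a * x i := fun i => by
    rw [← ha]; rfl
  simp only [localCoord, h]
  rw [mul_div_mul_left _ _ ha0, mul_div_mul_left _ _ ha0]

/-- The order of vanishing of a local coordinate, in terms of homogeneous coordinates. -/
lemma IsLiftAt.analyticOrderAt_localCoord (hg : IsLiftAt F g z) :
    analyticOrderAt (fun w => localCoord (F z) (F w)) z =
      analyticOrderAt (fun w => wedge (F z).rep (g w)) z := by
  set y := (F z).rep with hy
  have hy0 : y ≠ 0 := (F z).rep_nonzero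
  have hgy : wedge y (g z) = 0 := (hg.apply_eq_iff _).1 rfl
  obtain ⟨a, ha⟩ := exists_smul_of_wedge_eq_zero hy0 hgy
  have ha0 : a ≠ 0 := by
    rintro rfl
    exact hg.ne_zero (by simpa using ha)
  have hga := analyticAt_pi_iff.1 hg.1
  suffices ∃ e : ℂ → ℂ, AnalyticAt ℂ e z ∧ e z ≠ 0 ∧
      ∀ᶠ w in 𝓝 z, localCoord (F z) (F w) = wedge y (g w) * e w by
    obtain ⟨e, he, he0, h⟩ := this
    rw [analyticOrderAt_congr h]
    have := analyticOrderAt_mul (analyticAt_wedge (analyticAt_const (v := y)) hg.1) he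
    rw [he.analyticOrderAt_eq_zero.2 he0, add_zero] at this
    exact this
  by_cases h1 : y 1 = 0
  · have h0 : y 0 ≠ 0 := fun h0 => hy0 (by ext i; fin_cases i <;> simp [h0, h1])
    have hg0 : g z 0 ≠ 0 := by rw [ha]; simp [ha0, h0]
    refine ⟨fun w => (y 0 * g w 0)⁻¹, (analyticAt_const.mul (hga 0)).inv (mul_ne_zero h0 hg0),
      inv_ne_zero (mul_ne_zero h0 hg0), ?_⟩
    filter_upwards [hg.2, (hga 0).continuousAt.eventually_ne hg0] with w ⟨hw, hF⟩ hw0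
    rw [hF, localCoord_mk, if_pos h1, wedge, h1]
    field_simp
    ring
  · have hg1 : g z 1 ≠ 0 := by rw [ha]; simp [ha0, h1]
    refine ⟨fun w => -(y 1 * g w 1)⁻¹, ((analyticAt_const.mul (hga 1)).inv
      (mul_ne_zero h1 hg1)).neg, neg_ne_zero.2 (inv_ne_zero (mul_ne_zero h1 hg1)), ?_⟩
    filter_upwards [hg.2, (hga 1).continuousAt.eventually_ne hg1] with w ⟨hw, hF⟩ hw1
    rw [hF, localCoord_mk, if_neg h1, wedge, ← hy]
    field_simp
    ring

/-- The order of vanishing is positive, and it exceeds one where the Wronskian vanishes. -/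
lemma IsLiftAt.one_le_order (hg : IsLiftAt F g z) :
    1 ≤ analyticOrderAt (fun w => wedge (F z).rep (g w)) z := by
  rw [Order.one_le_iff_ne_zero]
  exact analyticOrderAt_ne_zero.2
    ⟨analyticAt_wedge analyticAt_const hg.1, (hg.apply_eq_iff _).1 rfl⟩

/-- The order exceeds one when the derivative `wedge y (deriv g z)` vanishes too, where `y`
represents `F z`; and `g z` is a nonzero multiple of `y`. -/
lemma IsLiftAt.one_lt_order_iff (hg : IsLiftAt F g z) :
    1 < analyticOrderAt (fun w => wedge (F z).rep (g w)) z ↔ wedge (g z) (deriv g z) = 0 := by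
  have hgy : wedge (F z).rep (g z) = 0 := (hg.apply_eq_iff _).1 rfl
  have hA : AnalyticAt ℂ (fun w => wedge (F z).rep (g w)) z :=
    analyticAt_wedge analyticAt_const hg.1
  have h := hA.analyticOrderAt_deriv_add_one
  simp only [hgy, sub_zero] at h
  obtain ⟨a, ha⟩ := exists_smul_of_wedge_eq_zero (F z).rep_nonzero hgy
  have ha0 : a ≠ 0 := by
    rintro rfl
    exact hg.ne_zero (by simpa using ha)
  rw [← h, ha, wedge_smul_left, mul_eq_zero, or_iff_right ha0,
    ← (hasDerivAt_wedge (F z).rep hg.1).deriv]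
  rw [← not_iff_not, ← ne_eq (deriv _ _), ← hA.deriv.analyticOrderAt_eq_zero, not_lt]
  generalize analyticOrderAt (deriv fun w => wedge (F z).rep (g w)) z = n
  cases n with
  | top => simp
  | coe n => norm_cast; simp

end Lift

/-! ### Holomorphic maps to the line and the identity theorem -/

/-- Holomorphic maps from the plane to the projective line. -/
def IsHolomorphic (F : ℂ → P1) : Prop := ∀ z, ∃ g, IsLiftAt F g z

lemma IsHolomorphic.comp {F : ℂ → P1} (hF : IsHolomorphic F) {φ : ℂ → ℂ}
    (hφ : ∀ z, AnalyticAt ℂ φ z) : IsHolomorphic (F ∘ φ) := fun z => by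
  obtain ⟨g, hg⟩ := hF (φ z)
  exact ⟨_, hg.comp (hφ z) rfl⟩

/-- The identity theorem for holomorphic maps to the projective line. -/
lemma IsHolomorphic.eq_of_eventuallyEq {F G : ℂ → P1} (hF : IsHolomorphic F)
    (hG : IsHolomorphic G) {z₀ : ℂ} (h : F =ᶠ[𝓝 z₀] G) : F = G := by
  have key : ∀ z, (∃ᶠ w in 𝓝[≠] z, F w = G w) → F =ᶠ[𝓝 z] G := by
    intro z hz
    obtain ⟨a, ha⟩ := hF z
    obtain ⟨b, hb⟩ := hG z
    have hiff : ∀ᶠ w in 𝓝 z, F w = G w ↔ wedge (a w) (b w) = 0 := by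
      filter_upwards [ha.2, hb.2] with w ⟨h1, h2⟩ ⟨h3, h4⟩
      rw [h2, h4, mk_eq_mk_iff_wedge]
    have h0 : ∀ᶠ w in 𝓝 z, wedge (a w) (b w) = 0 := by
      refine (analyticAt_wedge ha.1 hb.1).frequently_zero_iff_eventually_zero.1 ?_
      exact (hz.and_eventually (nhdsWithin_le_nhds hiff)).mono fun w hw => hw.2.1 hw.1
    filter_upwards [h0, hiff] with w h1 h2
    exact h2.2 h1
  have hopen : IsOpen {z | F =ᶠ[𝓝 z] G} := isOpen_setOfPred_eventually_nhds
  have hclosed : IsClosed {z | F =ᶠ[𝓝 z] G} := by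
    refine isClosed_of_closure_subset fun z hz => ?_
    by_cases hmem : F =ᶠ[𝓝 z] G
    · exact hmem
    refine key z ?_
    have h1 : ∃ᶠ w in 𝓝 z, F =ᶠ[𝓝 w] G := mem_closure_iff_frequently.1 hz
    refine frequently_nhdsWithin_iff.2 (h1.mono fun w hw => ⟨hw.self_of_nhds, ?_⟩)
    rintro rfl
    exact hmem hw
  have := IsClopen.eq_univ ⟨hclosed, hopen⟩ ⟨z₀, h⟩
  funext z
  exact (this.symm ▸ Set.mem_univ z : z ∈ {z | F =ᶠ[𝓝 z] G}).self_of_nhds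

/-! ### The pulled back cubic differential -/

/-- The Plücker relation between the Wronskian and the derivative of a quotient of linear forms. -/
lemma wedge_mul_wedge_sub (v₁ v₂ x y : Fin 2 → ℂ) :
    wedge v₁ y * wedge v₂ x - wedge v₁ x * wedge v₂ y = -(wedge v₁ v₂ * wedge x y) := by
  simp only [wedge]; ring

lemma wedge_ne_zero_of_wedge_eq_zero {v₁ v₂ x : Fin 2 → ℂ} (h₁₂ : wedge v₁ v₂ ≠ 0)
    (hx : x ≠ 0) (h : wedge v₁ x = 0) : wedge v₂ x ≠ 0 := by
  have h₁ : v₁ ≠ 0 := by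
    rintro rfl
    exact h₁₂ (by simp [wedge])
  obtain ⟨a, rfl⟩ := exists_smul_of_wedge_eq_zero h₁ h
  have ha : a ≠ 0 := by
    rintro rfl
    exact hx (by simp)
  rw [wedge_smul_right]
  refine mul_ne_zero ha fun h' => h₁₂ ?_
  simp only [wedge] at h' ⊢
  linear_combination -h'

/-- The product of the linear forms that vanish on the lines spanned by three vectors. -/
def cubicForm (v : Fin 3 → Fin 2 → ℂ) (x : Fin 2 → ℂ) : ℂ :=
  wedge (v 0) x * wedge (v 1) x * wedge (v 2) x

lemma cubicForm_smul (v : Fin 3 → Fin 2 → ℂ) (a : ℂ) (x : Fin 2 → ℂ) :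
    cubicForm v (a • x) = a ^ 3 * cubicForm v x := by
  simp only [cubicForm, wedge_smul_right]; ring

lemma cubicForm_ne_zero {v : Fin 3 → Fin 2 → ℂ} {x : Fin 2 → ℂ} (h : ∀ i, wedge (v i) x ≠ 0) :
    cubicForm v x ≠ 0 :=
  mul_ne_zero (mul_ne_zero (h 0) (h 1)) (h 2)

lemma analyticAt_cubicForm (v : Fin 3 → Fin 2 → ℂ) {g : ℂ → Fin 2 → ℂ} {z : ℂ}
    (hg : AnalyticAt ℂ g z) : AnalyticAt ℂ (fun w => cubicForm v (g w)) z :=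
  ((analyticAt_wedge analyticAt_const hg).mul (analyticAt_wedge analyticAt_const hg)).mul
    (analyticAt_wedge analyticAt_const hg)

/-- `F` takes the values represented by `v 0`, `v 1` and `v 2` with multiplicity three only. -/
structure IsTripleOver (F : ℂ → P1) (v : Fin 3 → Fin 2 → ℂ) : Prop where
  isHolomorphic : IsHolomorphic F
  independent : ∀ i j, i ≠ j → wedge (v i) (v j) ≠ 0
  order_eq : ∀ (i : Fin 3) (z : ℂ) (g : ℂ → Fin 2 → ℂ), IsLiftAt F g z → wedge (v i) (g z) = 0 →
    analyticOrderAt (fun w => wedge (v i) (g w)) z = 3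

/-- `h` is the coefficient around `z` of the pullback under `F` of the cubic differential with
double poles at `v 0`, `v 1` and `v 2`. -/
def IsTensorAt (F : ℂ → P1) (v : Fin 3 → Fin 2 → ℂ) (h : ℂ → ℂ) (z : ℂ) : Prop :=
  AnalyticAt ℂ h z ∧ ∃ g, IsLiftAt F g z ∧
    ∀ᶠ w in 𝓝 z, h w * cubicForm v (g w) ^ 2 = wedge (g w) (deriv g w) ^ 3

/-- The form `wedge v₁ (g w)` vanishes to order three at `z` and the Wronskian to order two, so both
sides of the equation vanish to order six and their quotient is a unit. -/
lemma exists_tensor_of_order_eq {v₁ v₂ v₃ : Fin 2 → ℂ} {g : ℂ → Fin 2 → ℂ} {z : ℂ}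
    (hg : AnalyticAt ℂ g z) (h₁₂ : wedge v₁ v₂ ≠ 0)
    (h₁ : analyticOrderAt (fun w => wedge v₁ (g w)) z = 3)
    (h₂ : wedge v₂ (g z) ≠ 0) (h₃ : wedge v₃ (g z) ≠ 0) :
    ∃ h : ℂ → ℂ, AnalyticAt ℂ h z ∧ h z ≠ 0 ∧ ∀ᶠ w in 𝓝 z,
      h w * (wedge v₁ (g w) * wedge v₂ (g w) * wedge v₃ (g w)) ^ 2 =
        wedge (g w) (deriv g w) ^ 3 := by
  have hA : ∀ v, AnalyticAt ℂ (fun w => wedge v (g w)) z := fun v =>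
    analyticAt_wedge analyticAt_const hg
  obtain ⟨e, he, he0, hue⟩ := ((hA v₁).analyticOrderAt_eq_natCast (n := 3)).1 h₁
  have hd : AnalyticAt ℂ (fun w => wedge v₂ (deriv g w)) z :=
    analyticAt_wedge analyticAt_const hg.deriv
  have hed : AnalyticAt ℂ (deriv e) z := he.deriv
  have hA₂ := hA v₂
  have hA₃ := hA v₃
  -- Substituting `wedge v₁ (g w) = (w - z) ^ 3 * e w` in the Plücker relation gives the Wronskian
  -- as `-(w - z) ^ 2 * r w / wedge v₁ v₂`.
  set r : ℂ → ℂ := fun w => (3 * e w + (w - z) * deriv e w) * wedge v₂ (g w) -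
    (w - z) * e w * wedge v₂ (deriv g w) with hr
  have hra : AnalyticAt ℂ r z := by fun_prop
  have hr0 : r z ≠ 0 := by simp [hr, he0, h₂]
  refine ⟨fun w => -r w ^ 3 / (wedge v₁ v₂ ^ 3 * e w ^ 2 * wedge v₂ (g w) ^ 2 *
    wedge v₃ (g w) ^ 2), ?_, ?_, ?_⟩
  · refine (hra.pow 3).neg.div (by fun_prop) ?_
    simp [h₁₂, he0, h₂, h₃]
  · simp [h₁₂, he0, h₂, h₃, hr0]
  · filter_upwards [hue.eventually_nhds, he.eventually_analyticAt, hg.eventually_analyticAt,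
      he.continuousAt.eventually_ne he0, hA₂.continuousAt.eventually_ne h₂,
      hA₃.continuousAt.eventually_ne h₃] with w h1 h2 h3 h4 h5 h6
    have hL : wedge v₁ (g w) = (w - z) ^ 3 * e w := h1.self_of_nhds
    have hL' : wedge v₁ (deriv g w) = 3 * (w - z) ^ 2 * e w + (w - z) ^ 3 * deriv e w := by
      refine (hasDerivAt_wedge v₁ h3).unique (HasDerivAt.congr_of_eventuallyEq ?_ h1)
      have := (((hasDerivAt_id w).sub_const z).pow 3).mul h2.differentiableAt.hasDerivAt
      simpa [Pi.mul_def, Pi.pow_def] using this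
    have hP := wedge_mul_wedge_sub v₁ v₂ (g w) (deriv g w)
    have hW : wedge (g w) (deriv g w) = -((w - z) ^ 2 * r w) / wedge v₁ v₂ := by
      rw [eq_div_iff h₁₂, hr]
      rw [hL, hL'] at hP
      linear_combination hP
    rw [hW, hL]
    field_simp

lemma IsTripleOver.exists_tensor {F : ℂ → P1} {v : Fin 3 → Fin 2 → ℂ} (hF : IsTripleOver F v)
    (z : ℂ) : ∃ h, IsTensorAt F v h z ∧ ((∃ g i, IsLiftAt F g z ∧ wedge (v i) (g z) = 0) →
      h z ≠ 0) := by
  obtain ⟨g, hg⟩ := hF.isHolomorphic z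
  have hne : ∀ i j, i ≠ j → wedge (v i) (g z) = 0 → wedge (v j) (g z) ≠ 0 := fun i j hij h =>
    wedge_ne_zero_of_wedge_eq_zero (hF.independent i j hij) hg.ne_zero h
  have aux : ∀ i j k : Fin 3, i ≠ j → i ≠ k → (∀ x, cubicForm v x =
      wedge (v i) x * wedge (v j) x * wedge (v k) x) → wedge (v i) (g z) = 0 →
      ∃ h, IsTensorAt F v h z ∧ h z ≠ 0 := by
    intro i j k hij hik hc h0
    obtain ⟨h, h1, h2, h3⟩ := exists_tensor_of_order_eq hg.1 (hF.independent i j hij)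
      (hF.order_eq i z g hg h0) (hne i j hij h0) (hne i k hik h0)
    exact ⟨h, ⟨h1, g, hg, by simpa only [hc] using h3⟩, h2⟩
  by_cases hall : ∀ i, wedge (v i) (g z) ≠ 0
  · have hq : cubicForm v (g z) ≠ 0 := cubicForm_ne_zero hall
    have hqa := analyticAt_cubicForm v hg.1
    refine ⟨fun w => wedge (g w) (deriv g w) ^ 3 / cubicForm v (g w) ^ 2,
      ⟨((analyticAt_wedge hg.1 hg.1.deriv).pow 3).div (hqa.pow 2) (pow_ne_zero 2 hq), g, hg, ?_⟩,
      ?_⟩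
    · filter_upwards [hqa.continuousAt.eventually_ne hq] with w hw
      rw [div_mul_cancel₀ _ (pow_ne_zero 2 hw)]
    · rintro ⟨g', i, hg', hi⟩
      obtain ⟨c, -, -, hc⟩ := hg'.exists_smul hg
      exact absurd (by rw [hc.self_of_nhds, wedge_smul_right, hi, mul_zero]) (hall i)
  · push Not at hall
    obtain ⟨i, hi⟩ := hall
    have : ∃ h, IsTensorAt F v h z ∧ h z ≠ 0 := by
      fin_cases i
      · exact aux 0 1 2 (by decide) (by decide) (fun x => rfl) hi
      · exact aux 1 0 2 (by decide) (by decide) (fun x => by simp only [cubicForm]; ring) hi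
      · exact aux 2 0 1 (by decide) (by decide) (fun x => by simp only [cubicForm]; ring) hi
    obtain ⟨h, h1, h2⟩ := this
    exact ⟨h, h1, fun _ => h2⟩

lemma IsTripleOver.eventually_cubicForm_ne_zero {F : ℂ → P1} {v : Fin 3 → Fin 2 → ℂ}
    (hF : IsTripleOver F v) {g : ℂ → Fin 2 → ℂ} {z : ℂ} (hg : IsLiftAt F g z) :
    ∀ᶠ w in 𝓝[≠] z, cubicForm v (g w) ≠ 0 := by
  have : ∀ i, ∀ᶠ w in 𝓝[≠] z, wedge (v i) (g w) ≠ 0 := fun i => by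
    have hA : AnalyticAt ℂ (fun w => wedge (v i) (g w)) z :=
      analyticAt_wedge analyticAt_const hg.1
    refine hA.eventually_eq_zero_or_eventually_ne_zero.resolve_left fun h => ?_
    have := hF.order_eq i z g hg h.self_of_nhds
    rw [analyticOrderAt_eq_top.2 h] at this
    exact ENat.top_ne_ofNat 3 this
  filter_upwards [this 0, this 1, this 2] with w h0 h1 h2
  exact mul_ne_zero (mul_ne_zero h0 h1) h2

/-- The defining equation of the tensor does not depend on the homogeneous coordinates. -/
lemma IsTensorAt.eventually_eq {F : ℂ → P1} {v : Fin 3 → Fin 2 → ℂ} {h : ℂ → ℂ} {z : ℂ}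
    (hh : IsTensorAt F v h z) {g : ℂ → Fin 2 → ℂ} (hg : IsLiftAt F g z) :
    ∀ᶠ w in 𝓝 z, h w * cubicForm v (g w) ^ 2 = wedge (g w) (deriv g w) ^ 3 := by
  obtain ⟨-, g', hg', he⟩ := hh
  obtain ⟨c, hc, -, hcg⟩ := hg'.exists_smul hg
  filter_upwards [he, hcg.eventually_nhds, hc.eventually_analyticAt,
    hg'.1.eventually_analyticAt] with w h1 h2 h3 h4
  have hd : deriv g w = c w • deriv g' w + deriv c w • g' w := by
    rw [Filter.EventuallyEq.deriv_eq h2]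
    exact (h3.differentiableAt.hasDerivAt.smul h4.differentiableAt.hasDerivAt).deriv
  have hW : wedge (g w) (deriv g w) = c w ^ 2 * wedge (g' w) (deriv g' w) := by
    rw [h2.self_of_nhds, hd]
    simp only [wedge, Pi.add_apply, Pi.smul_apply, smul_eq_mul]
    ring
  rw [hW, h2.self_of_nhds, cubicForm_smul]
  linear_combination c w ^ 6 * h1

/-- The cubic form is nonzero on a punctured neighbourhood, so the equation determines the
coefficient there, and by the identity theorem at `z` as well. -/
lemma IsTripleOver.tensor_unique {F : ℂ → P1} {v : Fin 3 → Fin 2 → ℂ} (hF : IsTripleOver F v)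
    {h₁ h₂ : ℂ → ℂ} {z : ℂ} (hh₁ : IsTensorAt F v h₁ z) (hh₂ : IsTensorAt F v h₂ z) :
    h₁ z = h₂ z := by
  obtain ⟨g, hg⟩ := hF.isHolomorphic z
  have : ∀ᶠ w in 𝓝[≠] z, h₁ w - h₂ w = 0 := by
    filter_upwards [nhdsWithin_le_nhds (hh₁.eventually_eq hg),
      nhdsWithin_le_nhds (hh₂.eventually_eq hg), hF.eventually_cubicForm_ne_zero hg] with w a b c
    rw [← b] at a
    exact sub_eq_zero.2 (mul_right_cancel₀ (pow_ne_zero 2 c) a)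
  have := ((hh₁.1.sub hh₂.1).frequently_zero_iff_eventually_zero.1 this.frequently).self_of_nhds
  exact sub_eq_zero.1 this

/-- For a doubly periodic map the tensor is constant. -/
theorem IsTripleOver.exists_const {F : ℂ → P1} {v : Fin 3 → Fin 2 → ℂ} (hF : IsTripleOver F v)
    (Λ : Submodule ℤ ℂ) [DiscreteTopology Λ] [IsZLattice ℝ Λ]
    (hΛ : ∀ z, ∀ l ∈ Λ, F (z + l) = F z) {z₀ : ℂ} {g₀ : ℂ → Fin 2 → ℂ} {i : Fin 3}
    (hg₀ : IsLiftAt F g₀ z₀) (hi : wedge (v i) (g₀ z₀) = 0) :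
    ∃ C : ℂ, C ≠ 0 ∧ ∀ z g, IsLiftAt F g z →
      ∀ᶠ w in 𝓝 z, C * cubicForm v (g w) ^ 2 = wedge (g w) (deriv g w) ^ 3 := by
  -- By uniqueness the local coefficients glue to the entire function `z ↦ h z z`, which inherits
  -- the periods of `F`.
  choose h hh hne using hF.exists_tensor
  have hloc : ∀ z, ∀ᶠ w in 𝓝 z, h w w = h z w := by
    intro z
    obtain ⟨h1, g, hg, h2⟩ := hh z
    filter_upwards [h1.eventually_analyticAt, hg.eventually_isLiftAt, h2.eventually_nhds]
      with w a b c
    exact hF.tensor_unique (hh w) ⟨a, g, b, c⟩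
  have hdiff : Differentiable ℂ fun z => h z z := fun z =>
    ((hh z).1.congr ((hloc z).mono fun w hw => hw.symm)).differentiableAt
  have hper : ∀ z l, l ∈ Λ → h (z + l) (z + l) = h z z := by
    intro z l hl
    obtain ⟨h1, g, hg, h2⟩ := hh z
    have hφ : AnalyticAt ℂ (fun w : ℂ => w - l) (z + l) := by fun_prop
    have hx : (fun w : ℂ => w - l) (z + l) = z := by simp
    have hlift : IsLiftAt F (g ∘ fun w => w - l) (z + l) := by
      have := hg.comp hφ hx
      have hFl : F ∘ (fun w => w - l) = F := by
        funext w
        have := hΛ (w - l) l hl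
        simpa using this.symm
      rwa [hFl] at this
    have ht : IsTensorAt F v (fun w => h z (w - l)) (z + l) := by
      refine ⟨AnalyticAt.fun_comp (by simpa using h1) hφ, _, hlift, ?_⟩
      have htend : Tendsto (fun w : ℂ => w - l) (𝓝 (z + l)) (𝓝 z) := by
        have := hφ.continuousAt.tendsto
        simpa using this
      filter_upwards [htend.eventually h2] with w hw
      have : deriv (g ∘ fun w => w - l) w = deriv g (w - l) := deriv_comp_sub_const g l w
      rw [this]
      exact hw
    have := hF.tensor_unique (hh (z + l)) ht
    simpa using this
  have hbdd : Bornology.IsBounded (Set.range fun z => h z z) :=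
    (IsZLattice.isCompact_range_of_periodic Λ _ hdiff.continuous hper).isBounded
  have hconst : ∀ z, h z z = h z₀ z₀ := fun z => hdiff.apply_eq_apply_of_bounded hbdd z z₀
  refine ⟨h z₀ z₀, hne z₀ ⟨g₀, i, hg₀, hi⟩, fun z g hg => ?_⟩
  filter_upwards [hloc z, (hh z).eventually_eq hg] with w h1 h2
  rwa [← hconst w, h1]

/-! ### Rigidity of maps triply ramified over three points -/

/-- The differential equation satisfied by the affine coordinate of a map around a point over
`v 0`. -/
lemma IsTripleOver.exists_coordinate {F : ℂ → P1} {v : Fin 3 → Fin 2 → ℂ} (hF : IsTripleOver F v)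
    {g : ℂ → Fin 2 → ℂ} (hg : IsLiftAt F g 0) (h0 : wedge (v 0) (g 0) = 0) {C : ℂ}
    (hC : ∀ᶠ w in 𝓝 0, C * cubicForm v (g w) ^ 2 = wedge (g w) (deriv g w) ^ 3) :
    AnalyticAt ℂ (fun w => wedge (v 0) (g w) / wedge (v 1) (g w)) 0 ∧
    analyticOrderAt (fun w => wedge (v 0) (g w) / wedge (v 1) (g w)) 0 = 3 ∧
    (∀ᶠ w in 𝓝 0, wedge (v 1) (g w) ≠ 0) ∧
    ∀ᶠ z in 𝓝 0, deriv (fun w => wedge (v 0) (g w) / wedge (v 1) (g w)) z ^ 3 =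
      -(wedge (v 0) (v 1) * C) * ((wedge (v 0) (g z) / wedge (v 1) (g z)) ^ 2 *
        (wedge (v 2) (v 1) * (wedge (v 0) (g z) / wedge (v 1) (g z)) + wedge (v 0) (v 2)) ^ 2) := by
  have h01 := hF.independent 0 1 (by decide)
  have h1 : wedge (v 1) (g 0) ≠ 0 := wedge_ne_zero_of_wedge_eq_zero h01 hg.ne_zero h0
  have hA : ∀ i, AnalyticAt ℂ (fun w => wedge (v i) (g w)) 0 := fun i =>
    analyticAt_wedge analyticAt_const hg.1
  refine ⟨(hA 0).div (hA 1) h1, ?_, (hA 1).continuousAt.eventually_ne h1, ?_⟩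
  · have h := analyticOrderAt_mul (hA 0) ((hA 1).inv h1)
    rw [((hA 1).inv h1).analyticOrderAt_eq_zero.2 (inv_ne_zero h1), add_zero,
      hF.order_eq 0 0 g hg h0] at h
    rw [← h]
    rfl
  · filter_upwards [hC, (hA 1).continuousAt.eventually_ne h1, hg.1.eventually_analyticAt]
      with z hz hne ha
    have hd := ((hasDerivAt_wedge (v 0) ha).div (hasDerivAt_wedge (v 1) ha) hne).deriv
    rw [wedge_mul_wedge_sub] at hd
    simp only [Pi.div_def] at hd
    rw [hd]
    -- Three linear forms in two variables are dependent: the third is expressed through the first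
    -- two.
    have h2 : wedge (v 2) (g z) * wedge (v 0) (v 1) =
        wedge (v 2) (v 1) * wedge (v 0) (g z) + wedge (v 0) (v 2) * wedge (v 1) (g z) := by
      simp only [wedge]; ring
    have h3 : wedge (v 2) (v 1) * (wedge (v 0) (g z) / wedge (v 1) (g z)) + wedge (v 0) (v 2) =
        wedge (v 2) (g z) * wedge (v 0) (v 1) / wedge (v 1) (g z) := by
      rw [h2]
      field_simp
    rw [cubicForm] at hz
    rw [h3]
    field_simp
    linear_combination hz

/-- Two maps triply ramified over the same three points agree up to scaling the variable. -/
theorem IsTripleOver.exists_forall_eq {F G : ℂ → P1} {v : Fin 3 → Fin 2 → ℂ}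
    (hF : IsTripleOver F v) (hG : IsTripleOver G v) {a b : ℂ → Fin 2 → ℂ}
    (ha : IsLiftAt F a 0) (hb : IsLiftAt G b 0)
    (ha0 : wedge (v 0) (a 0) = 0) (hb0 : wedge (v 0) (b 0) = 0) {C C' : ℂ}
    (hC : C ≠ 0) (hC' : C' ≠ 0)
    (hCF : ∀ᶠ w in 𝓝 0, C * cubicForm v (a w) ^ 2 = wedge (a w) (deriv a w) ^ 3)
    (hCG : ∀ᶠ w in 𝓝 0, C' * cubicForm v (b w) ^ 2 = wedge (b w) (deriv b w) ^ 3) :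
    ∃ κ : ℂ, κ ≠ 0 ∧ ∀ ζ : ℂ, ζ ^ 3 = 1 → ∀ z, F z = G (ζ * κ * z) := by
  have h01 := hF.independent 0 1 (by decide)
  have h02 := hF.independent 0 2 (by decide)
  obtain ⟨hu, hu3, hau, hdu⟩ := hF.exists_coordinate ha ha0 hCF
  obtain ⟨hv, hv3, hbv, hdv⟩ := hG.exists_coordinate hb hb0 hCG
  have hP : ∀ᶠ x : ℂ in 𝓝[≠] 0,
      x ^ 2 * (wedge (v 2) (v 1) * x + wedge (v 0) (v 2)) ^ 2 ≠ 0 := by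
    have : ContinuousAt (fun x : ℂ => wedge (v 2) (v 1) * x + wedge (v 0) (v 2)) 0 := by fun_prop
    filter_upwards [self_mem_nhdsWithin, nhdsWithin_le_nhds (this.eventually_ne (y := 0)
      (by simpa using h02))] with x h1 h2
    exact mul_ne_zero (pow_ne_zero 2 h1) (pow_ne_zero 2 h2)
  -- Both coordinates satisfy the equation with the same `P`; `C` and `C'` enter only through the
  -- constant factors.
  obtain ⟨κ, hκ, h⟩ := exists_eventually_eq_comp_mul hu hv hu3 hv3
    (P := fun x => x ^ 2 * (wedge (v 2) (v 1) * x + wedge (v 0) (v 2)) ^ 2)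
    (neg_ne_zero.2 (mul_ne_zero h01 hC)) (neg_ne_zero.2 (mul_ne_zero h01 hC')) hP hdu hdv
  refine ⟨κ, hκ, fun ζ hζ => ?_⟩
  have hφ : ∀ z, AnalyticAt ℂ (fun z : ℂ => ζ * κ * z) z := fun z => by fun_prop
  have ht : Tendsto (fun z : ℂ => ζ * κ * z) (𝓝 0) (𝓝 0) := by
    have := (hφ 0).continuousAt.tendsto
    simpa using this
  refine congrFun (IsHolomorphic.eq_of_eventuallyEq (z₀ := 0) hF.isHolomorphic
    (hG.isHolomorphic.comp hφ) ?_)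
  filter_upwards [h ζ hζ, hau, ht.eventually hbv, ha.2, ht.eventually hb.2]
    with z h1 h2 h3 ⟨h4, h5⟩ ⟨h6, h7⟩
  rw [h5, h7, mk_eq_mk_iff_wedge]
  rw [div_eq_div_iff h2 h3] at h1
  refine (mul_eq_zero.1 ?_).resolve_left h01
  have := wedge_mul_wedge_sub (v 0) (v 1) (a z) (b (ζ * κ * z))
  linear_combination this + h1

/-- A map that is invariant under a nontrivial rotation about a point is ramified there. -/
lemma IsLiftAt.wronskian_eq_zero {F : ℂ → P1} {g : ℂ → Fin 2 → ℂ} {z ω : ℂ}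
    (hg : IsLiftAt F g z) (hω : ω ≠ 1) (hF : ∀ w, F (z + ω * (w - z)) = F w) :
    wedge (g z) (deriv g z) = 0 := by
  have hφ : AnalyticAt ℂ (fun w => z + ω * (w - z)) z := by fun_prop
  have hz : z + ω * (z - z) = z := by ring
  have hlift : IsLiftAt F (g ∘ fun w => z + ω * (w - z)) z := by
    have := hg.comp hφ hz
    rwa [show F ∘ (fun w => z + ω * (w - z)) = F from funext hF] at this
  obtain ⟨c, hc, -, h⟩ := hg.exists_smul hlift
  have h0 := h.self_of_nhds
  have hc1 : c z = 1 := by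
    rw [Function.comp_apply, hz] at h0
    have : (c z - 1) • g z = 0 := by rw [sub_smul, one_smul, ← h0, sub_self]
    exact sub_eq_zero.1 ((smul_eq_zero.1 this).resolve_right hg.ne_zero)
  have h1 : HasDerivAt (g ∘ fun w => z + ω * (w - z)) (ω • deriv g z) z := by
    have hd : HasDerivAt g (deriv g z) (z + ω * (z - z)) := by
      rw [hz]
      exact hg.1.differentiableAt.hasDerivAt
    have hd' : HasDerivAt (fun w => z + ω * (w - z)) ω z := by
      simpa using (((hasDerivAt_id z).sub_const z).const_mul ω).const_add z
    exact hd.scomp z hd'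
  have h2 := hc.differentiableAt.hasDerivAt.smul hg.1.differentiableAt.hasDerivAt
  have h3 := h1.unique (h2.congr_of_eventuallyEq h)
  have h4 : wedge (g z) (ω • deriv g z) = wedge (g z) (c z • deriv g z + deriv c z • g z) := by
    rw [h3]
  -- Modulo `g z` the invariance reads `ω • deriv g z = deriv g z`, whence `(ω - 1)` times the
  -- Wronskian is zero.
  rw [wedge_smul_right, hc1] at h4
  simp only [wedge, Pi.add_apply, Pi.smul_apply, smul_eq_mul] at h4
  refine (mul_eq_zero.1 (?_ : (ω - 1) * wedge (g z) (deriv g z) = 0)).resolve_left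
    (sub_ne_zero.2 hω)
  simp only [wedge]
  linear_combination h4

/-! ### Ramification of triple covers -/

section TripleCovers

variable {Λ : Submodule ℤ ℂ} {f : ℂ ⧸ Λ → P1}

lemma exists_eq_add_mk (o p : ℂ ⧸ Λ) : ∃ z : ℂ, p = o + Submodule.Quotient.mk z := by
  obtain ⟨z, hz⟩ := Submodule.Quotient.mk_surjective Λ (p - o)
  exact ⟨z, by rw [hz, add_sub_cancel]⟩

lemma IsMorphism.isHolomorphic (hf : IsMorphism f) (o : ℂ ⧸ Λ) :
    IsHolomorphic fun z => f (o + Submodule.Quotient.mk z) := by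
  intro z
  obtain ⟨g, hg, h⟩ := hf (o + Submodule.Quotient.mk z)
  have hφ : AnalyticAt ℂ (fun w => w - z) z := by fun_prop
  have ht : Tendsto (fun w => w - z) (𝓝 z) (𝓝 0) := by
    have := hφ.continuousAt.tendsto
    simpa using this
  refine ⟨fun w => g (w - z), AnalyticAt.fun_comp (by simpa using hg) hφ, ?_⟩
  filter_upwards [ht.eventually h] with w ⟨h1, h2⟩
  refine ⟨h1, ?_⟩
  rw [← h2, add_assoc, ← Submodule.Quotient.mk_add, add_sub_cancel]

lemma IsLiftAt.ramificationIndex_eq {o : ℂ ⧸ Λ} {g : ℂ → Fin 2 → ℂ} {z : ℂ}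
    (hg : IsLiftAt (fun z => f (o + Submodule.Quotient.mk z)) g z) :
    ramificationIndex f (o + Submodule.Quotient.mk z) =
      analyticOrderAt (fun w => wedge (f (o + Submodule.Quotient.mk z)).rep (g w)) z := by
  have hφ : AnalyticAt ℂ (fun w => z + w) 0 := by fun_prop
  have h := analyticOrderAt_comp_of_deriv_ne_zero (f := fun w =>
    localCoord (f (o + Submodule.Quotient.mk z)) (f (o + Submodule.Quotient.mk w))) hφ
    (by simp)
  rw [add_zero, hg.analyticOrderAt_localCoord] at h
  rw [← h, ramificationIndex]
  simp only [Function.comp_def, add_assoc, Submodule.Quotient.mk_add]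

lemma IsMorphism.one_le_ramificationIndex (hf : IsMorphism f) (p : ℂ ⧸ Λ) :
    1 ≤ ramificationIndex f p := by
  obtain ⟨z, rfl⟩ := exists_eq_add_mk 0 p
  obtain ⟨g, hg⟩ := hf.isHolomorphic 0 z
  rw [hg.ramificationIndex_eq]
  exact hg.one_le_order

/-- A point of ramification index `3` is alone in its fibre. -/
lemma IsTripleCover.eq_of_apply_eq (hf : IsTripleCover f) {a q : ℂ ⧸ Λ}
    (ha : ramificationIndex f a = 3) (h : f q = f a) : q = a := by
  classical
  by_contra hne
  obtain ⟨hfin, hsum⟩ := hf.hasDegree (f a)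
  rw [finsum_mem_eq_finite_toFinset_sum _ hfin] at hsum
  have hsub : ({a, q} : Finset (ℂ ⧸ Λ)) ⊆ hfin.toFinset := by
    intro x hx
    rcases Finset.mem_insert.1 hx with rfl | hx
    · simp
    · rw [Finset.mem_singleton.1 hx]
      simp [h]
  have h1 := Finset.sum_le_sum_of_subset (f := ramificationIndex f) hsub
  rw [hsum, Finset.sum_pair (Ne.symm hne), ha] at h1
  have h2 : (3 : ℕ∞) + 1 ≤ 3 :=
    (add_le_add_right (hf.isMorphism.one_le_ramificationIndex q) 3).trans h1
  exact absurd h2 (by decide)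

/-- A point of index three fills its fibre. Therefore the three values are distinct, and each is
taken only at lattice translates of one point, with order three. -/
lemma IsTripleCover.isTripleOver (hf : IsTripleCover f) {a b c : ℂ ⧸ Λ} (hab : a ≠ b) (hac : a ≠ c)
    (hbc : b ≠ c) (ha : ramificationIndex f a = 3) (hb : ramificationIndex f b = 3)
    (hc : ramificationIndex f c = 3) :
    IsTripleOver (fun z => f (a + Submodule.Quotient.mk z))
      ![(f a).rep, (f b).rep, (f c).rep] := by
  have hne : ∀ p q : ℂ ⧸ Λ, ramificationIndex f p = 3 → p ≠ q →
      wedge (f p).rep (f q).rep ≠ 0 := by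
    intro p q hp hpq h
    exact hpq (hf.eq_of_apply_eq hp (eq_iff_wedge.2 h).symm).symm
  have hord : ∀ p : ℂ ⧸ Λ, ramificationIndex f p = 3 → ∀ (z : ℂ) (g : ℂ → Fin 2 → ℂ),
      IsLiftAt (fun z => f (a + Submodule.Quotient.mk z)) g z → wedge (f p).rep (g z) = 0 →
      analyticOrderAt (fun w => wedge (f p).rep (g w)) z = 3 := by
    intro p hp z g hg h
    have h1 : f (a + Submodule.Quotient.mk z) = f p := (hg.apply_eq_iff _).2 h
    have h2 := hg.ramificationIndex_eq
    rw [h1, hf.eq_of_apply_eq hp h1, hp] at h2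
    exact h2.symm
  refine ⟨hf.isMorphism.isHolomorphic a, fun i j hij => ?_, fun i => ?_⟩
  · fin_cases i <;> fin_cases j
    · exact absurd rfl hij
    · exact hne a b ha hab
    · exact hne a c ha hac
    · exact hne b a hb hab.symm
    · exact absurd rfl hij
    · exact hne b c hb hbc
    · exact hne c a hc hac.symm
    · exact hne c b hc hbc.symm
    · exact absurd rfl hij
  · fin_cases i
    · exact hord a ha
    · exact hord b hb
    · exact hord c hc

/-- The cubic differential of a triple cover, read around a ramification point. -/
lemma IsTripleCover.exists_const [DiscreteTopology Λ] [IsZLattice ℝ Λ] (hf : IsTripleCover f)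
    {a b c : ℂ ⧸ Λ} (hab : a ≠ b) (hac : a ≠ c)
    (hbc : b ≠ c) (ha : ramificationIndex f a = 3) (hb : ramificationIndex f b = 3)
    (hc : ramificationIndex f c = 3) :
    ∃ C : ℂ, C ≠ 0 ∧ ∀ z g, IsLiftAt (fun z => f (a + Submodule.Quotient.mk z)) g z →
      ∀ᶠ w in 𝓝 z, C * cubicForm ![(f a).rep, (f b).rep, (f c).rep] (g w) ^ 2 =
        wedge (g w) (deriv g w) ^ 3 := by
  obtain ⟨g, hg⟩ := hf.isMorphism.isHolomorphic a 0
  refine (hf.isTripleOver hab hac hbc ha hb hc).exists_const Λ (fun z l hl => ?_) (i := 0) hg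
    ((hg.apply_eq_iff _).1 (by simp))
  rw [Submodule.Quotient.mk_add, (Submodule.Quotient.mk_eq_zero Λ).2 hl, add_zero]

/-- The Riemann-Hurwitz formula for a triple cover: besides the three points of triple ramification
there is no ramification. -/
theorem IsTripleCover.eq_or_eq_or_eq [DiscreteTopology Λ] [IsZLattice ℝ Λ] (hf : IsTripleCover f)
    {a b c : ℂ ⧸ Λ} (hab : a ≠ b) (hac : a ≠ c)
    (hbc : b ≠ c) (ha : ramificationIndex f a = 3) (hb : ramificationIndex f b = 3)
    (hc : ramificationIndex f c = 3) {p : ℂ ⧸ Λ} (hp : 1 < ramificationIndex f p) :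
    p = a ∨ p = b ∨ p = c := by
  obtain ⟨C, hC0, hC⟩ := hf.exists_const hab hac hbc ha hb hc
  obtain ⟨z, rfl⟩ := exists_eq_add_mk a p
  obtain ⟨g, hg⟩ := hf.isMorphism.isHolomorphic a z
  rw [hg.ramificationIndex_eq, hg.one_lt_order_iff] at hp
  by_contra! hne
  have hw : ∀ q, ramificationIndex f q = 3 → a + Submodule.Quotient.mk z ≠ q →
      wedge (f q).rep (g z) ≠ 0 := fun q hq h h' =>
    h (hf.eq_of_apply_eq hq ((hg.apply_eq_iff _).2 h'))
  have h := (hC z g hg).self_of_nhds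
  rw [hp, zero_pow (by norm_num)] at h
  refine mul_ne_zero hC0 (pow_ne_zero 2 (cubicForm_ne_zero fun i => ?_)) h
  fin_cases i
  · exact hw a ha hne.1
  · exact hw b hb hne.2.1
  · exact hw c hc hne.2.2

/-- Every ramification point belongs to the triple of points of ramification index three. -/
lemma IsTripleCover.exists_of_one_lt [DiscreteTopology Λ] [IsZLattice ℝ Λ] (hf : IsTripleCover f)
    {o : ℂ ⧸ Λ} (ho : 1 < ramificationIndex f o) :
    ∃ b c : ℂ ⧸ Λ, o ≠ b ∧ o ≠ c ∧ b ≠ c ∧ ramificationIndex f o = 3 ∧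
      ramificationIndex f b = 3 ∧ ramificationIndex f c = 3 := by
  obtain ⟨a, b, c, hab, hac, hbc, ha, hb, hc⟩ := hf.triple
  rcases hf.eq_or_eq_or_eq hab hac hbc ha hb hc ho with rfl | rfl | rfl
  · exact ⟨b, c, hab, hac, hbc, ha, hb, hc⟩
  · exact ⟨a, c, hab.symm, hbc, hac, hb, ha, hc⟩
  · exact ⟨a, b, hac.symm, hbc.symm, hab, hc, ha, hb⟩

lemma IsTripleCover.ramificationIndex_eq_three [DiscreteTopology Λ] [IsZLattice ℝ Λ]
    (hf : IsTripleCover f) {o : ℂ ⧸ Λ} (ho : 1 < ramificationIndex f o) :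
    ramificationIndex f o = 3 := by
  obtain ⟨b, c, -, -, -, h, -⟩ := hf.exists_of_one_lt ho
  exact h

lemma one_lt_of_eq_three {p : ℂ ⧸ Λ} (hp : ramificationIndex f p = 3) :
    1 < ramificationIndex f p := by
  rw [hp]; decide

end TripleCovers

/-! ### Torsion points of the torus -/

/-- The torsion subgroup of a complex torus has the expected order. -/
lemma card_torsionBy (Λ : Submodule ℤ ℂ) [DiscreteTopology Λ] [IsZLattice ℝ Λ] {n : ℕ}
    (hn : n ≠ 0) : Nat.card (AddSubgroup.torsionBy (ℂ ⧸ Λ) (n : ℤ)) = n ^ 2 := by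
  have := ZLattice.module_free ℝ Λ
  have := ZLattice.module_finite ℝ Λ
  have hn' : (n : ℂ) ≠ 0 := Nat.cast_ne_zero.2 hn
  -- Division by `n` induces `Λ / nΛ ≃ T[n]`, and `nΛ` has index `n ^ 2` because `Λ` has rank two.
  let φ : Λ →+ ℂ ⧸ Λ :=
    { toFun := fun l => Submodule.Quotient.mk ((l : ℂ) / n)
      map_zero' := by simp
      map_add' := fun x y => by
        rw [← Submodule.Quotient.mk_add, Submodule.coe_add, add_div] }
  have hφ : ∀ l : Λ, φ l = Submodule.Quotient.mk ((l : ℂ) / n) := fun _ => rfl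
  have hker : φ.ker = (nsmulAddMonoidHom (α := Λ) n).range := by
    ext l
    rw [AddMonoidHom.mem_ker, AddMonoidHom.mem_range, hφ, Submodule.Quotient.mk_eq_zero]
    constructor
    · intro h
      refine ⟨⟨_, h⟩, Subtype.ext ?_⟩
      simp only [nsmulAddMonoidHom_apply, AddSubmonoidClass.coe_nsmul, nsmul_eq_mul]
      field_simp
    · rintro ⟨x, rfl⟩
      convert x.2 using 1
      simp only [nsmulAddMonoidHom_apply, AddSubmonoidClass.coe_nsmul, nsmul_eq_mul]
      field_simp
  have hrange : φ.range = AddSubgroup.torsionBy (ℂ ⧸ Λ) (n : ℤ) := by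
    ext p
    rw [AddMonoidHom.mem_range, AddSubgroup.torsionBy.nsmul_iff]
    obtain ⟨z, rfl⟩ := Submodule.Quotient.mk_surjective Λ p
    constructor
    · rintro ⟨l, hl⟩
      rw [← hl, hφ, ← Submodule.Quotient.mk_smul, Submodule.Quotient.mk_eq_zero]
      convert l.2 using 1
      rw [nsmul_eq_mul]
      field_simp
    · intro h
      rw [← Submodule.Quotient.mk_smul, Submodule.Quotient.mk_eq_zero] at h
      refine ⟨⟨_, h⟩, ?_⟩
      rw [hφ]
      congr 1
      simp only [nsmul_eq_mul]
      field_simp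
  rw [← hrange, ← AddSubgroup.index_ker, hker, AddSubgroup.index_range_nsmul,
    ZLattice.rank ℝ Λ, Complex.finrank_real_complex]

lemma mk_mem_torsionWithZero {Λ : Submodule ℤ ℂ} (o : ℂ ⧸ Λ) (n : ℕ) (z : ℂ) :
    o + Submodule.Quotient.mk z ∈ torsionWithZero o n ↔ (n : ℂ) * z ∈ Λ := by
  rw [torsionWithZero, Set.mem_ofPred_eq, add_sub_cancel_left, ← Submodule.Quotient.mk_smul,
    Submodule.Quotient.mk_eq_zero, nsmul_eq_mul]

lemma torsionWithZero_eq_image {Λ : Submodule ℤ ℂ} (o : ℂ ⧸ Λ) (n : ℕ) :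
    torsionWithZero o n =
      (fun p => o + p) '' (AddSubgroup.torsionBy (ℂ ⧸ Λ) (n : ℤ) : Set (ℂ ⧸ Λ)) := by
  ext p
  simp only [torsionWithZero, Set.mem_ofPred_eq, Set.mem_image, SetLike.mem_coe,
    AddSubgroup.torsionBy.nsmul_iff]
  constructor
  · intro h
    exact ⟨p - o, h, by abel⟩
  · rintro ⟨q, hq, rfl⟩
    rwa [add_sub_cancel_left]

/-! ### Comparison of covers with the same branch locus -/

section Comparison

variable {Λ Λ' : Submodule ℤ ℂ} {f : ℂ ⧸ Λ → P1} {f' : ℂ ⧸ Λ' → P1}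

/-- Two triple covers with the same branch locus differ by a similarity, which may be multiplied
by any cube root of unity. -/
theorem IsTripleCover.exists_similarity [DiscreteTopology Λ] [IsZLattice ℝ Λ]
    [DiscreteTopology Λ'] [IsZLattice ℝ Λ'] (hf : IsTripleCover f) (hf' : IsTripleCover f')
    (hM : branchLocus f = branchLocus f') {o : ℂ ⧸ Λ} {o' : ℂ ⧸ Λ'}
    (ho : 1 < ramificationIndex f o) (ho' : 1 < ramificationIndex f' o') (h : f o = f' o') :
    ∃ κ : ℂ, κ ≠ 0 ∧ ∀ ζ : ℂ, ζ ^ 3 = 1 → ∀ z : ℂ,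
      f (o + Submodule.Quotient.mk z) = f' (o' + Submodule.Quotient.mk (ζ * κ * z)) := by
  obtain ⟨b, c, hob, hoc, hbc, ho3, hb3, hc3⟩ := hf.exists_of_one_lt ho
  have hM' : ∀ p, ramificationIndex f p = 3 → ∃ p', ramificationIndex f' p' = 3 ∧
      f' p' = f p := by
    intro p hp
    have : f p ∈ branchLocus f' := hM ▸ ⟨p, one_lt_of_eq_three hp, rfl⟩
    obtain ⟨p', h1, h2⟩ := this
    exact ⟨p', hf'.ramificationIndex_eq_three h1, h2⟩
  obtain ⟨b', hb3', hbb⟩ := hM' b hb3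
  obtain ⟨c', hc3', hcc⟩ := hM' c hc3
  have ho3' := hf'.ramificationIndex_eq_three ho'
  have hob' : o' ≠ b' := by
    rintro rfl
    exact hob (hf.eq_of_apply_eq hb3 (h.trans hbb))
  have hoc' : o' ≠ c' := by
    rintro rfl
    exact hoc (hf.eq_of_apply_eq hc3 (h.trans hcc))
  have hbc' : b' ≠ c' := by
    rintro rfl
    exact hbc (hf.eq_of_apply_eq hc3 (hbb.symm.trans hcc))
  obtain ⟨C, hC, hCF⟩ := hf.exists_const hob hoc hbc ho3 hb3 hc3
  obtain ⟨C', hC', hCG⟩ := hf'.exists_const hob' hoc' hbc' ho3' hb3' hc3'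
  have hF := hf.isTripleOver hob hoc hbc ho3 hb3 hc3
  have hG := hf'.isTripleOver hob' hoc' hbc' ho3' hb3' hc3'
  rw [hbb, hcc, ← h] at hCG hG
  obtain ⟨a, ha⟩ := hF.isHolomorphic 0
  obtain ⟨a', ha'⟩ := hG.isHolomorphic 0
  exact hF.exists_forall_eq hG ha ha' ((ha.apply_eq_iff _).1 (by simp))
    ((ha'.apply_eq_iff _).1 (by simp [h])) hC hC' (hCF 0 a ha) (hCG 0 a' ha')

/-- A period `l` brings `o` back to itself, so `o' + κ * l` lies in the fibre of the triple point
`o'`, which is a single point. -/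
lemma IsTripleCover.mul_mem_of_forall_eq (hf' : IsTripleCover f') {o : ℂ ⧸ Λ} {o' : ℂ ⧸ Λ'}
    (ho' : ramificationIndex f' o' = 3) {κ : ℂ}
    (h : ∀ z : ℂ, f (o + Submodule.Quotient.mk z) = f' (o' + Submodule.Quotient.mk (κ * z)))
    {l : ℂ} (hl : l ∈ Λ) : κ * l ∈ Λ' := by
  have h0 := h 0
  have h1 := h l
  rw [(Submodule.Quotient.mk_eq_zero Λ).2 hl, ← Submodule.Quotient.mk_zero, h0] at h1
  rw [mul_zero, Submodule.Quotient.mk_zero, add_zero] at h1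
  have := hf'.eq_of_apply_eq ho' h1.symm
  rwa [add_eq_left, Submodule.Quotient.mk_eq_zero] at this

lemma IsTripleCover.image_torsion_subset [DiscreteTopology Λ] [IsZLattice ℝ Λ]
    [DiscreteTopology Λ'] [IsZLattice ℝ Λ'] (hf : IsTripleCover f) (hf' : IsTripleCover f')
    (hM : branchLocus f = branchLocus f') {o : ℂ ⧸ Λ} {o' : ℂ ⧸ Λ'}
    (ho : 1 < ramificationIndex f o) (ho' : 1 < ramificationIndex f' o') (h : f o = f' o')
    (n : ℕ) : f '' torsionWithZero o n ⊆ f' '' torsionWithZero o' n := by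
  obtain ⟨κ, -, hκ⟩ := hf.exists_similarity hf' hM ho ho' h
  have hκ' := hκ 1 (one_pow 3)
  rw [one_mul] at hκ'
  rintro _ ⟨p, hp, rfl⟩
  obtain ⟨z, rfl⟩ := exists_eq_add_mk o p
  refine ⟨_, ?_, (hκ' z).symm⟩
  rw [mk_mem_torsionWithZero] at hp ⊢
  have := hf'.mul_mem_of_forall_eq (hf'.ramificationIndex_eq_three ho') hκ' hp
  rwa [mul_left_comm] at this

end Comparison

/-! ### Rotational symmetry and fibres -/

section Rotation

variable {Λ : Submodule ℤ ℂ} {f : ℂ ⧸ Λ → P1}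

lemma exists_cube_root_of_unity : ∃ ω : ℂ, ω ≠ 1 ∧ ω ^ 2 + ω + 1 = 0 := by
  have h := Complex.isPrimitiveRoot_exp 3 (by norm_num)
  refine ⟨_, h.ne_one (by norm_num), ?_⟩
  have h1 := sub_ne_zero.2 (h.ne_one (by norm_num))
  have h2 := h.pow_eq_one
  refine (mul_eq_zero.1 ?_).resolve_left h1
  linear_combination h2

/-- The fibre through an unramified point has three elements. -/
lemma IsTripleCover.ncard_fibre (hf : IsTripleCover f) {y : P1} (hy : y ∉ branchLocus f) :
    (f ⁻¹' {y}).ncard = 3 := by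
  obtain ⟨hfin, hsum⟩ := hf.hasDegree y
  have h1 : ∀ p ∈ f ⁻¹' {y}, ramificationIndex f p = 1 := fun p hp =>
    le_antisymm (not_lt.1 fun h => hy ⟨p, h, hp⟩) (hf.isMorphism.one_le_ramificationIndex p)
  rw [finsum_mem_congr rfl h1, finsum_mem_eq_finite_toFinset_sum _ hfin] at hsum
  rw [Set.ncard_eq_toFinset_card _ hfin]
  simp only [Finset.sum_const, nsmul_eq_mul, mul_one] at hsum
  exact_mod_cast hsum

variable [DiscreteTopology Λ] [IsZLattice ℝ Λ]

/-- A triple cover is invariant under rotation by a third of a turn about a ramification point. -/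
lemma IsTripleCover.apply_rotation (hf : IsTripleCover f) {o : ℂ ⧸ Λ}
    (ho : 1 < ramificationIndex f o) {ω : ℂ} (hω : ω ^ 2 + ω + 1 = 0) (z : ℂ) :
    f (o + Submodule.Quotient.mk z) = f (o + Submodule.Quotient.mk (ω * z)) := by
  obtain ⟨κ, hκ, h⟩ := hf.exists_similarity hf rfl ho ho rfl
  have h3 : ω ^ 3 = 1 := by linear_combination (ω - 1) * hω
  -- The cover is compared with itself: the similarities with factors `κ` and `ω * κ` are both
  -- valid, and their quotient is the rotation.
  have h1 := h 1 (one_pow 3) (z / κ)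
  have h2 := h ω h3 (z / κ)
  rw [h1] at h2
  convert h2 using 4 <;> field_simp

lemma IsTripleCover.rotation_mem (hf : IsTripleCover f) {o : ℂ ⧸ Λ}
    (ho : 1 < ramificationIndex f o) {ω : ℂ} (hω : ω ^ 2 + ω + 1 = 0) {l : ℂ} (hl : l ∈ Λ) :
    ω * l ∈ Λ :=
  hf.mul_mem_of_forall_eq (hf.ramificationIndex_eq_three ho) (hf.apply_rotation ho hω) hl

/-- The ramification points differ by `3`-torsion points. -/
lemma IsTripleCover.three_nsmul_sub (hf : IsTripleCover f) {o b : ℂ ⧸ Λ}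
    (ho : 1 < ramificationIndex f o) (hb : 1 < ramificationIndex f b) : 3 • (b - o) = 0 := by
  obtain ⟨ω, -, hω⟩ := exists_cube_root_of_unity
  obtain ⟨z, rfl⟩ := exists_eq_add_mk o b
  have h := hf.eq_of_apply_eq (hf.ramificationIndex_eq_three hb) (hf.apply_rotation ho hω z).symm
  rw [add_right_inj, Submodule.Quotient.eq] at h
  rw [add_sub_cancel_left, ← Submodule.Quotient.mk_smul, Submodule.Quotient.mk_eq_zero]
  -- From `ω * z - z ∈ Λ`, applying `ω ^ 2 - 1` stays in `Λ`, and `(ω ^ 2 - 1) * (ω - 1) = 3`.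
  convert Λ.sub_mem (hf.rotation_mem ho hω (hf.rotation_mem ho hω h)) h using 1
  rw [nsmul_eq_mul]
  push_cast
  linear_combination (-ω + 2) * z * hω

lemma IsTripleCover.torsionWithZero_eq (hf : IsTripleCover f) {o b : ℂ ⧸ Λ}
    (ho : 1 < ramificationIndex f o) (hb : 1 < ramificationIndex f b) (m : ℕ) :
    torsionWithZero o (3 * m) = torsionWithZero b (3 * m) := by
  ext p
  have h : (3 * m) • (p - o) = (3 * m) • (p - b) := by
    have : p - o = (p - b) + (b - o) := by abel
    rw [this, smul_add, mul_comm, mul_smul m 3 (b - o), hf.three_nsmul_sub ho hb, smul_zero,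
      add_zero]
  rw [torsionWithZero, torsionWithZero, Set.mem_ofPred_eq, Set.mem_ofPred_eq, h]

lemma IsTripleCover.mem_torsionWithZero (hf : IsTripleCover f) {o b : ℂ ⧸ Λ}
    (ho : 1 < ramificationIndex f o) (hb : 1 < ramificationIndex f b) (m : ℕ) :
    b ∈ torsionWithZero o (3 * m) := by
  rw [hf.torsionWithZero_eq ho hb, torsionWithZero, Set.mem_ofPred_eq, sub_self, smul_zero]

/-- The fibre through an unramified point is an orbit of the rotation. -/
lemma IsTripleCover.fibre_eq (hf : IsTripleCover f) {o : ℂ ⧸ Λ}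
    (ho : 1 < ramificationIndex f o) {ω : ℂ} (hω1 : ω ≠ 1) (hω : ω ^ 2 + ω + 1 = 0) {z : ℂ}
    (hz : f (o + Submodule.Quotient.mk z) ∉ branchLocus f) :
    f ⁻¹' {f (o + Submodule.Quotient.mk z)} =
      {o + Submodule.Quotient.mk z, o + Submodule.Quotient.mk (ω * z),
        o + Submodule.Quotient.mk (ω * (ω * z))} := by
  have hrot := hf.apply_rotation ho hω
  have hmem := fun l => hf.rotation_mem ho hω (l := l)
  -- If this were a period, the map would also be invariant under the rotation about `z`, hence
  -- ramified there.
  have hne : z - ω * z ∉ Λ := by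
    intro hl
    have hF : ∀ w, f (o + Submodule.Quotient.mk (z + ω * (w - z))) =
        f (o + Submodule.Quotient.mk w) := by
      intro w
      rw [hrot w]
      congr 2
      rw [Submodule.Quotient.eq]
      convert hl using 1
      ring
    obtain ⟨g, hg⟩ := hf.isMorphism.isHolomorphic o z
    have := hg.wronskian_eq_zero hω1 hF
    rw [← hg.one_lt_order_iff, ← hg.ramificationIndex_eq] at this
    exact hz ⟨_, this, rfl⟩
  refine (Set.eq_of_subset_of_ncard_le ?_ ?_ (hf.hasDegree _).1).symm
  · rintro p (rfl | rfl | rfl)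
    · rfl
    · exact (hrot z).symm
    · exact ((hrot z).trans (hrot _)).symm
  · rw [hf.ncard_fibre hz, Set.ncard_eq_three.2 ⟨_, _, _, ?_, ?_, ?_, rfl⟩]
    · intro h
      rw [add_right_inj, Submodule.Quotient.eq] at h
      exact hne h
    · intro h
      rw [add_right_inj, Submodule.Quotient.eq] at h
      refine hne ?_
      convert Λ.neg_mem (hmem _ h) using 1
      linear_combination (1 - ω) * z * hω
    · intro h
      rw [add_right_inj, Submodule.Quotient.eq] at h
      refine hne ?_
      convert hmem _ (hmem _ h) using 1
      linear_combination (1 - ω) ^ 2 * z * hω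

/-- A fibre is a single point over the branch locus and a rotation orbit elsewhere. Rotation
preserves `Λ`, hence the torsion condition. -/
lemma IsTripleCover.preimage_image_torsion (hf : IsTripleCover f) {o : ℂ ⧸ Λ}
    (ho : 1 < ramificationIndex f o) (n : ℕ) :
    f ⁻¹' (f '' torsionWithZero o n) = torsionWithZero o n := by
  refine Set.Subset.antisymm ?_ (Set.subset_preimage_image f _)
  rintro p ⟨q, hq, hqp⟩
  obtain ⟨z, rfl⟩ := exists_eq_add_mk o q
  by_cases hbr : f (o + Submodule.Quotient.mk z) ∈ branchLocus f
  · obtain ⟨r, hr, hrz⟩ := hbr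
    have hr3 := hf.ramificationIndex_eq_three hr
    rw [hf.eq_of_apply_eq hr3 (hqp.symm.trans hrz.symm), ← hf.eq_of_apply_eq hr3 hrz.symm]
    exact hq
  · obtain ⟨ω, hω1, hω⟩ := exists_cube_root_of_unity
    have hp : p ∈ f ⁻¹' {f (o + Submodule.Quotient.mk z)} := hqp.symm
    rw [hf.fibre_eq ho hω1 hω hbr] at hp
    have hmem : ∀ w : ℂ, (n : ℂ) * w ∈ Λ → (n : ℂ) * (ω * w) ∈ Λ := fun w hw => by
      rw [mul_left_comm]
      exact hf.rotation_mem ho hω hw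
    rw [mk_mem_torsionWithZero] at hq
    rcases hp with rfl | rfl | rfl <;> rw [mk_mem_torsionWithZero]
    · exact hq
    · exact hmem _ hq
    · exact hmem _ (hmem _ hq)

end Rotation

/-! ### Independence of choices and the count -/

section Parameters

variable {Λ : Submodule ℤ ℂ} [DiscreteTopology Λ] [IsZLattice ℝ Λ] {f : ℂ ⧸ Λ → P1}

/-- Every choice of the data yields the same set of torsion parameters. -/
theorem IsTripleCover.isTorsionImage_iff (hf : IsTripleCover f) {o : ℂ ⧸ Λ}
    (ho : 1 < ramificationIndex f o) (m : ℕ) (S : Set P1) :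
    IsTorsionImage (branchLocus f) (3 * m) S ↔
      S = (f '' torsionWithZero o (3 * m)) \ branchLocus f := by
  constructor
  · rintro ⟨Λ', _, _, f', q, hf', hM, hq, rfl⟩
    -- The zero `q` is replaced by the ramification point of `f'` over `f o`; this leaves the
    -- `3m`-torsion unchanged.
    have : f o ∈ branchLocus f' := hM ▸ ⟨o, ho, rfl⟩
    obtain ⟨o', ho', h⟩ := this
    rw [hf'.torsionWithZero_eq hq ho']
    congr 1
    exact Set.Subset.antisymm (hf'.image_torsion_subset hf hM ho' ho h _)
      (hf.image_torsion_subset hf' hM.symm ho ho' h.symm _)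
  · rintro rfl
    exact ⟨Λ, inferInstance, inferInstance, f, o, hf, rfl, ho, rfl⟩

theorem IsTripleCover.equianharmonicParameters_eq (hf : IsTripleCover f) {o : ℂ ⧸ Λ}
    (ho : 1 < ramificationIndex f o) (m : ℕ) :
    equianharmonicParameters (branchLocus f) (3 * m) =
      (f '' torsionWithZero o (3 * m)) \ branchLocus f := by
  simp only [equianharmonicParameters, hf.isTorsionImage_iff ho]
  exact Set.sUnion_singleton _

theorem IsTripleCover.branchLocus_subset (hf : IsTripleCover f) {o : ℂ ⧸ Λ}
    (ho : 1 < ramificationIndex f o) (m : ℕ) :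
    branchLocus f ⊆ f '' torsionWithZero o (3 * m) :=
  Set.image_mono fun _ hb => hf.mem_torsionWithZero ho hb m

lemma ncard_torsionWithZero (o : ℂ ⧸ Λ) {n : ℕ} (hn : n ≠ 0) :
    (torsionWithZero o n).ncard = n ^ 2 := by
  rw [torsionWithZero_eq_image, Set.ncard_image_of_injective _ (add_right_injective o),
    ← card_torsionBy Λ hn]
  rfl

theorem IsTripleCover.ncard_parameters (hf : IsTripleCover f) {o : ℂ ⧸ Λ}
    (ho : 1 < ramificationIndex f o) {m : ℕ} (hm : 0 < m) :
    ((f '' torsionWithZero o (3 * m)) \ branchLocus f).ncard = 3 * m ^ 2 - 1 := by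
  classical
  have hcard := ncard_torsionWithZero o (n := 3 * m) (by positivity)
  -- Infinite sets have `ncard` zero, so a positive count gives finiteness.
  have hfin : (torsionWithZero o (3 * m)).Finite :=
    Set.finite_of_ncard_ne_zero (by rw [hcard]; positivity)
  obtain ⟨b, c, hob, hoc, hbc, ho3, hb3, hc3⟩ := hf.exists_of_one_lt ho
  set R : Set (ℂ ⧸ Λ) := {p | 1 < ramificationIndex f p} with hR
  have hRsub : R ⊆ torsionWithZero o (3 * m) := fun p hp => hf.mem_torsionWithZero ho hp m
  have hR3 : R.ncard = 3 := by
    refine Set.ncard_eq_three.2 ⟨o, b, c, hob, hoc, hbc, ?_⟩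
    ext p
    constructor
    · exact hf.eq_or_eq_or_eq hob hoc hbc ho3 hb3 hc3
    · rintro (rfl | rfl | rfl) <;> exact one_lt_of_eq_three ‹_›
  set S := (f '' torsionWithZero o (3 * m)) \ branchLocus f with hS
  have hSfin : S.Finite := (hfin.image f).sdiff
  have hpre : torsionWithZero o (3 * m) \ R = f ⁻¹' S := by
    rw [hS, Set.preimage_sdiff, hf.preimage_image_torsion ho]
    congr 1
    refine Set.Subset.antisymm (Set.subset_preimage_image f R) ?_
    rintro p ⟨q, hq, hqp⟩
    rwa [hf.eq_of_apply_eq (hf.ramificationIndex_eq_three hq) hqp.symm]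
  have hDfin : (f ⁻¹' S).Finite := hpre ▸ hfin.sdiff
  have hD : (f ⁻¹' S).ncard = (3 * m) ^ 2 - 3 := by
    rw [← hpre, Set.ncard_sdiff hRsub (hfin.subset hRsub), hcard, hR3]
  -- `S` avoids the branch locus, so every fibre over it has exactly three points.
  have hcount : (f ⁻¹' S).ncard = S.ncard * 3 := by
    rw [Set.ncard_eq_toFinset_card _ hDfin, Set.ncard_eq_toFinset_card _ hSfin]
    rw [Finset.card_eq_sum_card_fiberwise (f := f) (t := hSfin.toFinset) (by simp [Set.MapsTo]),
      Finset.sum_const_nat]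
    intro y hy
    have hyS : y ∈ S := by simpa using hy
    rw [← hf.ncard_fibre hyS.2, ← Set.ncard_coe_finset]
    congr 1
    ext p
    simp only [Finset.coe_filter, Set.Finite.mem_toFinset, Set.mem_preimage, Set.mem_ofPred_eq,
      Set.mem_singleton_iff, and_iff_right_iff_imp]
    rintro rfl
    exact hyS
  have : 0 < m ^ 2 := by positivity
  rw [mul_pow] at hD
  omega

end Parameters

end TripleCover

theorem mainTheorem6 (Λ : Submodule ℤ ℂ) [DiscreteTopology Λ] [IsZLattice ℝ Λ]
    (f : ℂ ⧸ Λ → TripleCover.P1) (hf : TripleCover.IsTripleCover f) (m : ℕ) (hm : 0 < m) :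
    -- the choices made in defining the set of parameters do not matter
    (∀ S, TripleCover.IsTorsionImage (TripleCover.branchLocus f) (3 * m) S ↔
      S = TripleCover.equianharmonicParameters (TripleCover.branchLocus f) (3 * m)) ∧
    (TripleCover.equianharmonicParameters (TripleCover.branchLocus f) (3 * m)).ncard
      = 3 * m ^ 2 - 1 ∧
    ∃ t : ℂ ⧸ Λ,
      f ⁻¹' (TripleCover.branchLocus f ∪
          TripleCover.equianharmonicParameters (TripleCover.branchLocus f) (3 * m)) =
        (fun p => t + p) '' (AddSubgroup.torsionBy (ℂ ⧸ Λ) ((3 * m : ℕ) : ℤ) : Set (ℂ ⧸ Λ)) := by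
  obtain ⟨o, -, -, -, -, -, ho3, -⟩ := hf.triple
  have ho := TripleCover.one_lt_of_eq_three ho3
  rw [hf.equianharmonicParameters_eq ho]
  refine ⟨fun S => hf.isTorsionImage_iff ho m S, hf.ncard_parameters ho hm, o, ?_⟩
  rw [Set.union_sdiff_cancel (hf.branchLocus_subset ho m), hf.preimage_image_torsion ho,
    TripleCover.torsionWithZero_eq_image]
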